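/- **Setting.** A *stateless protocol* on a directed graph $G=(V,E)$ consists of a nonempty finite label space $\Sigma$ and, for every node $i\in V$, a reaction function $\delta_i:\Sigma^{-i}\times\{0,1\}\to\Sigma^{+i}\times\{0,1\}$, where $-i$ and $+i$ are the sets of edges entering and leaving $i$. Given a global input $x\in\{0,1\}^V$ and an initial labeling $\ell^0\in\Sigma^E$, the protocol runs synchronously: for every $t\ge 1$ and every node $i$, $(\ell^t_{+i},y^t_i)=\delta_i(\ell^{t-1}_{-i},x_i)$. It *computes* $f:\{0,1\}^V\to\{0,1\}$ if for every $x$, every $\ell^0$ and every node $i$ the output sequence $y_i^1,y_i^2,\dots$ converges to $f(x)$. Its *round complexity* is the maximum, over all $x$ and $\ell^0$, of the first time step $t\geq 1$ from which on no output changes, and its *label complexity* is $\log_2|\Sigma|$. The bidirectional $N$-ring ($N\ge 3$) has the nodes $1,\dots,N$ and the edges $(i,i+1)$ and $(i+1,i)$, modulo $N$. Let $\widetilde{\mathrm{OS}}^b_{\log}$ be the class of all languages $\mathcal L\subseteq\{0,1\}^*$ for which there are a polynomially bounded function $p:\mathbb N\to\mathbb N$ with $p(n)\ge n$ and stateless protocols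 $A_n$ on the bidirectional $p(n)$-rings ($n\in\mathbb N$) such that the round complexity of $A_n$ is bounded by a polynomial in $n$, the label complexity of $A_n$ is $O(\log n)$, and $A_n$ computes the function $x\in\{0,1\}^{p(n)}\mapsto 1$ if $x_1\cdots x_n\in\mathcal L$, and $\mapsto 0$ otherwise. (The nodes $n+1,\dots,p(n)$ are helper nodes, whose inputs do not affect the function value.) Let $\mathrm{P/poly}$ be the class of all languages that are decided by a family of Boolean circuits of polynomial size, one circuit for every input length, with gates of fan-in at most $2$. **Theorem 5.** $\widetilde{\mathrm{OS}}^b_{\log}=\mathrm{P/poly}$. -/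

import Mathlib

open Filter Asymptotics

noncomputable section

namespace Stateless

/-! ### Stateless protocols on a directed graph, run synchronously -/

/-- The directed edges of `G`. -/
abbrev Edge {V : Type} (G : Digraph V) : Type := {e : V × V // G.Adj e.1 e.2}

/-- The edges entering `i`, given by their tails. -/
abbrev InEdge {V : Type} (G : Digraph V) (i : V) : Type := {j : V // G.Adj j i}

/-- The edges leaving `i`, given by their heads. -/
abbrev OutEdge {V : Type} (G : Digraph V) (i : V) : Type := {j : V // G.Adj i j}

/-- A stateless protocol on `G`: a nonempty finite label space `Label`, and for every node a
reaction function, which maps the labels of the incoming edges and the private input bit to the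
labels of the outgoing edges and an output bit. -/
structure Protocol {V : Type} (G : Digraph V) where
  Label : Type
  [fintypeLabel : Fintype Label]
  [nonemptyLabel : Nonempty Label]
  react : ∀ i : V, (InEdge G i → Label) × Bool → (OutEdge G i → Label) × Bool

attribute [instance] Protocol.fintypeLabel Protocol.nonemptyLabel

namespace Protocol

variable {V : Type} {G : Digraph V}

/-- A labeling of all edges. -/
abbrev Labeling (A : Protocol G) : Type := Edge G → A.Label

/-- What node `i` computes when it is activated under the labeling `l` and the input `x`. -/
def reaction (A : Protocol G) (x : V → Bool) (l : A.Labeling) (i : V) :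
    (OutEdge G i → A.Label) × Bool :=
  A.react i (fun j => l ⟨(j.1, i), j.2⟩, x i)

/-- One synchronous step: every node is activated, so every edge is relabeled by its tail. -/
def step (A : Protocol G) (x : V → Bool) (l : A.Labeling) : A.Labeling :=
  fun e => (A.reaction x l e.1.1).1 ⟨e.1.2, e.2⟩

/-- The labeling after `t` synchronous steps from the initial labeling `l₀`. -/
def labeling (A : Protocol G) (x : V → Bool) (l₀ : A.Labeling) : ℕ → A.Labeling
  | 0 => l₀
  | t + 1 => A.step x (A.labeling x l₀ t)

/-- The outputs of the nodes at time step `t + 1`, computed from the labeling at time `t`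
(there are no outputs at time `0`). -/
def outputSucc (A : Protocol G) (x : V → Bool) (l₀ : A.Labeling) (t : ℕ) (i : V) : Bool :=
  (A.reaction x (A.labeling x l₀ t) i).2

/-- `A` computes `f`: for every input and every initial labeling, the output sequence of every
node converges to the value of `f` at the input. -/
def Computes (A : Protocol G) (f : (V → Bool) → Bool) : Prop :=
  ∀ (x : V → Bool) (l₀ : A.Labeling) (i : V), ∀ᶠ t in atTop, A.outputSucc x l₀ t i = f x

/-- The number of time steps until the outputs have converged: the first time step `t + 1` from
which on no output changes (`⊤` if the outputs do not converge). -/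
def convergenceTime (A : Protocol G) (x : V → Bool) (l₀ : A.Labeling) : ℕ∞ :=
  ⨅ t ∈ {t : ℕ | ∀ s, t ≤ s → A.outputSucc x l₀ s = A.outputSucc x l₀ t}, ((t + 1 : ℕ) : ℕ∞)

/-- The round complexity: the maximal convergence time over all inputs and initial labelings. -/
def roundComplexity (A : Protocol G) : ℕ∞ :=
  ⨆ (x : V → Bool) (l₀ : A.Labeling), A.convergenceTime x l₀

/-- The label complexity: the length of a label in binary encoding. -/
def labelComplexity (A : Protocol G) : ℝ := Real.logb 2 (Fintype.card A.Label)

end Protocol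

/-- The bidirectional ring on the nodes `0, …, N - 1`: the edges are all pairs `(i, i + 1)` and
`(i + 1, i)`, modulo `N`. -/
def bidirectionalRing (N : ℕ) : Digraph (Fin N) where
  Adj i j := (i.1 + 1) % N = j.1 ∨ (j.1 + 1) % N = i.1

/-! ### Languages and the two classes -/

open Classical in
/-- The indicator function of the language `L` on words of length `n`. -/
def indicatorFn (L : Language Bool) (n : ℕ) (x : Fin n → Bool) : Bool :=
  decide (List.ofFn x ∈ L)

/-- A function on `ℕ` is polynomially bounded, with values in `ℕ∞` so that the bound also says
that the values are finite. -/
def PolyBounded (g : ℕ → ℕ∞) : Prop :=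
  ∃ q : Polynomial ℕ, ∀ n, g n ≤ ((q.eval n : ℕ) : ℕ∞)

/-- The languages decided by a family of stateless protocols `A n` on bidirectional rings of
polynomial size `p n`, with polynomial round complexity and label complexity `O(h n)`. The word is
given to the first `n` nodes; the other nodes are helpers, and the computed function does not
depend on their inputs. -/
def OSBidirHelpers (h : ℕ → ℝ) : Set (Language Bool) :=
  {L | ∃ (p : ℕ → ℕ) (hn : ∀ n, n ≤ p n)
      (A : ∀ n, Protocol (bidirectionalRing (p n))),
      (∀ n, 3 ≤ p n) ∧
      PolyBounded (fun n => (p n : ℕ∞)) ∧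
      PolyBounded (fun n => (A n).roundComplexity) ∧
      (fun n => (A n).labelComplexity) =O[atTop] h ∧
      ∀ n, (A n).Computes (fun x => indicatorFn L n (fun i => x (Fin.castLE (hn n) i)))}

/-! ### Boolean circuits and P/poly -/

/-- A Boolean gate of fan-in at most two whose inputs are wires from `W`. -/
inductive Gate (W : Type) : Type
  | const (b : Bool) : Gate W
  | not (u : W) : Gate W
  | and (u v : W) : Gate W
  | or (u v : W) : Gate W

/-- The value of a gate, given the values of the wires. -/
def Gate.eval {W : Type} (v : W → Bool) : Gate W → Bool
  | .const b => b
  | .not a => !(v a)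
  | .and a b => v a && v b
  | .or a b => v a || v b

/-- `GateSeq n s`: a list of `s` gates in topological order; the inputs of a gate are among the
`n` circuit inputs and the earlier gates. Fan-out is unbounded. -/
inductive GateSeq (n : ℕ) : ℕ → Type
  | nil : GateSeq n 0
  | snoc {s : ℕ} (c : GateSeq n s) (g : Gate (Fin n ⊕ Fin s)) : GateSeq n (s + 1)

/-- The values of all gates on the input `x`. -/
def GateSeq.values {n : ℕ} (x : Fin n → Bool) : {s : ℕ} → GateSeq n s → Fin s → Bool
  | _, .nil => Fin.elim0
  | _, .snoc c g => Fin.snoc (α := fun _ => Bool) (c.values x) (g.eval (Sum.elim x (c.values x)))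

/-- A Boolean circuit with `n` inputs and one output, which is a gate or an input. -/
structure BoolCircuit (n : ℕ) where
  /-- the number of gates -/
  size : ℕ
  gates : GateSeq n size
  output : Fin n ⊕ Fin size

/-- The function that a circuit computes. -/
def BoolCircuit.eval {n : ℕ} (C : BoolCircuit n) (x : Fin n → Bool) : Bool :=
  Sum.elim x (C.gates.values x) C.output

/-- P/poly: the languages decided by families of Boolean circuits of polynomial size. -/
def PPoly : Set (Language Bool) :=
  {L | ∃ C : ∀ n, BoolCircuit n,
      PolyBounded (fun n => ((C n).size : ℕ∞)) ∧
      ∀ n (x : Fin n → Bool), (C n).eval x = indicatorFn L n x}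

end Stateless

end

/-!
Both inclusions are simulations.

*Protocols by circuits.* Labels of length `O(log n)` come from a label space of polynomial size
(`exists_polynomial_card_label`), so a labeling has a one-hot encoding of polynomial size, and since
a node has at most two incoming edges, a reaction function is a case distinction over polynomially
many cases (`cost_reaction`). Unrolling as many steps as the round complexity allows, from an
arbitrary fixed initial labeling, gives a circuit (`exists_circuit_output`).

*Circuits by protocols.* The labels have to provide a memory, and the computation has to recover
from every initial labeling. Every input and every gate gets a node `i` of an even ring and becomes
a memory cell there: its content is sent to `i + 1`, which echoes it. Every clockwise edge also
carries a token. In one revolution a token collects the contents of the two operands of its target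
cell, which precede that cell, and then writes the target; after that it proceeds to the next
target. The target is advanced at node `0` only and all targets are legal, so tokens need no
initialization. The tokens do not coordinate their work either: once all cells before `i` are
correct forever, every token writes the correct value into cell `i` from its next revolution on
(`CellProgram.IsRun.memory_of_target`). A cell holds two
contents, one for each parity of the time. Since the ring is even, a token always comes back to a
node at times of the same parity, so after `N` revolutions it has written the content that it sees
(`CellProgram.IsRun.memory_stable_step`). Hence the cells stabilize in order, each within
`N ^ 2 + N + 3` steps after its predecessors, and the tokens spread the content of the output cell
over the ring (`CellProgram.IsRun.result_stable`).
-/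

namespace Stateless

/-! ### The bidirectional ring -/

theorem bidirectionalRing_adj_iff {N : ℕ} [NeZero N] (i j : Fin N) :
    (bidirectionalRing N).Adj i j ↔ j = i + 1 ∨ i = j + 1 := by
  simp [bidirectionalRing, Fin.ext_iff, Fin.val_add, eq_comm]

/-- The clockwise edge from `i` to `i + 1`. -/
def forwardEdge {N : ℕ} [NeZero N] (i : Fin N) : Edge (bidirectionalRing N) :=
  ⟨(i, i + 1), (bidirectionalRing_adj_iff _ _).2 (.inl rfl)⟩

/-- The counterclockwise edge from `i + 1` to `i`. -/
def backwardEdge {N : ℕ} [NeZero N] (i : Fin N) : Edge (bidirectionalRing N) :=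
  ⟨(i + 1, i), (bidirectionalRing_adj_iff _ _).2 (.inr rfl)⟩

/-! ### Counting the gates of a circuit -/

/-- The functions in `F` are all available as wires of a single sequence of `s` gates. -/
def Realizable {n : ℕ} (s : ℕ) (F : Set ((Fin n → Bool) → Bool)) : Prop :=
  ∃ c : GateSeq n s, ∀ f ∈ F, ∃ w, ∀ x, Sum.elim x (c.values x) w = f x

/-- At most `m` further gates compute `f` in any circuit that already computes the functions
in `F`. -/
def Cost {n : ℕ} (F : Set ((Fin n → Bool) → Bool)) (f : (Fin n → Bool) → Bool) (m : ℕ) : Prop :=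
  ∀ s F', F ⊆ F' → Realizable s F' → Realizable (s + m) (insert f F')

section Cost

variable {n s m m₁ m₂ : ℕ} {F F' : Set ((Fin n → Bool) → Bool)} {f g : (Fin n → Bool) → Bool}

theorem Realizable.subset (h : Realizable s F) (hF : F' ⊆ F) : Realizable s F' :=
  let ⟨c, hc⟩ := h
  ⟨c, fun f hf => hc f (hF hf)⟩

theorem GateSeq.elim_values_snoc (c : GateSeq n s) (g : Gate (Fin n ⊕ Fin s)) (x : Fin n → Bool)
    (w : Fin n ⊕ Fin s) :
    Sum.elim x ((c.snoc g).values x) (Sum.map id Fin.castSucc w) =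
      Sum.elim x (c.values x) w := by
  cases w <;> simp [GateSeq.values]

theorem realizable_insert_snoc (c : GateSeq n s)
    (hc : ∀ f ∈ F, ∃ w, ∀ x, Sum.elim x (c.values x) w = f x) (g : Gate (Fin n ⊕ Fin s))
    (hg : ∀ x, g.eval (Sum.elim x (c.values x)) = f x) : Realizable (s + 1) (insert f F) := by
  refine ⟨c.snoc g, fun k hk => ?_⟩
  rcases hk with rfl | hk
  · exact ⟨.inr (Fin.last s), fun x => by simp [GateSeq.values, hg]⟩
  · obtain ⟨w, hw⟩ := hc k hk
    exact ⟨_, fun x => (c.elim_values_snoc g x w).trans (hw x)⟩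

theorem Realizable.mono (h : Realizable s F) (hs : s ≤ m) : Realizable m F := by
  induction hs with
  | refl => exact h
  | step _ ih =>
    obtain ⟨c, hc⟩ := ih
    exact (realizable_insert_snoc (f := fun _ => false) c hc (.const false) fun _ => rfl).subset
      (Set.subset_insert _ _)

theorem Cost.mono (h : Cost F f m₁) (hm : m₁ ≤ m₂) : Cost F f m₂ := fun s F' hF hs =>
  (h s F' hF hs).mono (by omega)

theorem cost_of_mem (h : f ∈ F) : Cost F f 0 := fun s F' hF hs => by
  rwa [Set.insert_eq_of_mem (hF h)]

theorem cost_const (b : Bool) : Cost F (fun _ => b) 1 := fun _ _ _ ⟨c, hc⟩ =>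
  realizable_insert_snoc c hc (.const b) fun _ => rfl

theorem cost_input (i : Fin n) : Cost F (fun x => x i) 0 := by
  rintro s F' - ⟨c, hc⟩
  refine ⟨c, fun k hk => ?_⟩
  rcases hk with rfl | hk
  · exact ⟨.inl i, fun x => rfl⟩
  · exact hc k hk

theorem Cost.not (hf : Cost F f m) : Cost F (fun x => !f x) (m + 1) := by
  intro s F' hF hs
  obtain ⟨c, hc⟩ := hf s F' hF hs
  obtain ⟨w, hw⟩ := hc f (Set.mem_insert _ _)
  exact (realizable_insert_snoc (f := fun x => !f x) c hc (.not w) fun x => by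
    simp [Gate.eval, hw]).subset (Set.insert_subset_insert (Set.subset_insert _ _))

theorem Cost.and (hf : Cost F f m₁) (hg : Cost F g m₂) :
    Cost F (fun x => f x && g x) (m₁ + m₂ + 1) := by
  intro s F' hF hs
  obtain ⟨c, hc⟩ := hg _ _ (hF.trans (Set.subset_insert f F')) (hf s F' hF hs)
  obtain ⟨w, hw⟩ := hc f (by simp)
  obtain ⟨w', hw'⟩ := hc g (by simp)
  refine ((realizable_insert_snoc (f := fun x => f x && g x) c hc (.and w w') fun x => by
    simp [Gate.eval, hw, hw']).subset (Set.insert_subset_insert ?_)).mono (by omega)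
  exact (Set.subset_insert _ _).trans (Set.subset_insert _ _)

theorem Cost.or (hf : Cost F f m₁) (hg : Cost F g m₂) :
    Cost F (fun x => f x || g x) (m₁ + m₂ + 1) := by
  intro s F' hF hs
  obtain ⟨c, hc⟩ := hg _ _ (hF.trans (Set.subset_insert f F')) (hf s F' hF hs)
  obtain ⟨w, hw⟩ := hc f (by simp)
  obtain ⟨w', hw'⟩ := hc g (by simp)
  refine ((realizable_insert_snoc (f := fun x => f x || g x) c hc (.or w w') fun x => by
    simp [Gate.eval, hw, hw']).subset (Set.insert_subset_insert ?_)).mono (by omega)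
  exact (Set.subset_insert _ _).trans (Set.subset_insert _ _)

open Classical in
theorem cost_exists {κ : Type*} (S : Finset κ) (G : κ → (Fin n → Bool) → Bool)
    (hG : ∀ k ∈ S, Cost F (G k) m) :
    Cost F (fun x => decide (∃ k ∈ S, G k x = true)) (S.card * (m + 1) + 1) := by
  induction S using Finset.induction_on with
  | empty => simpa using cost_const (F := F) false
  | insert a S ha ih =>
    have h := (hG a (by simp)).or (ih fun k hk => hG k (by simp [hk]))
    rw [Finset.card_insert_of_notMem ha]
    convert h using 1
    · ext x
      simp
    · ring

/-- Case distinction on the value of `σ`, given by its one-hot encoding. -/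
theorem cost_select {κ : Type*} [Fintype κ] [DecidableEq κ] (σ : (Fin n → Bool) → κ)
    (φ : κ → (Fin n → Bool) → Bool) (hσ : ∀ k, Cost F (fun x => decide (σ x = k)) m₁)
    (hφ : ∀ k, Cost F (φ k) m₂) :
    Cost F (fun x => φ (σ x) x) (Fintype.card κ * (m₁ + m₂ + 2) + 1) := by
  have h := cost_exists Finset.univ (fun k x => decide (σ x = k) && φ k x)
    fun k _ => (hσ k).and (hφ k)
  convert h using 1
  · ext x
    simp
  · rfl

theorem Realizable.union_range {κ : Type*} [Fintype κ] {G : κ → (Fin n → Bool) → Bool}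
    (hG : ∀ k, Cost F (G k) m) (h : Realizable s F) :
    Realizable (s + Fintype.card κ * m) (F ∪ Set.range G) := by
  classical
  suffices ∀ S : Finset κ, Realizable (s + S.card * m) (F ∪ G '' S) by
    simpa [Set.image_univ] using this Finset.univ
  intro S
  induction S using Finset.induction_on with
  | empty => simpa using h
  | insert a S ha ih =>
    have := hG a _ _ Set.subset_union_left ih
    rw [Finset.card_insert_of_notMem ha, add_mul, one_mul, ← add_assoc, Finset.coe_insert,
      Set.image_insert_eq, Set.union_insert]
    exact this

end Cost

/-! ### Simulating a protocol by a circuit -/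

section Simulation

variable {N : ℕ} [NeZero N] (A : Protocol (bidirectionalRing N))

/-- The labels on the incoming edges of `i`, when `a` is the label from `i - 1` and `b` the label
from `i + 1`. -/
def incoming (i : Fin N) (a b : A.Label) (j : InEdge (bidirectionalRing N) i) : A.Label :=
  if i = j.1 + 1 then a else b

theorem reaction_eq_incoming (x : Fin N → Bool) (l : A.Labeling) (i : Fin N) :
    A.reaction x l i = A.react i
      (incoming A i (l ⟨(i - 1, i), (bidirectionalRing_adj_iff _ _).2 (.inl (by simp))⟩)
        (l (backwardEdge i)), x i) := by
  have : (fun j : InEdge (bidirectionalRing N) i => l ⟨(j.1, i), j.2⟩) =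
      incoming A i (l ⟨(i - 1, i), (bidirectionalRing_adj_iff _ _).2 (.inl (by simp))⟩)
        (l (backwardEdge i)) := by
    funext ⟨j, hj⟩
    rcases (bidirectionalRing_adj_iff _ _).1 hj with h | h
    · subst h
      simp [incoming]
    · subst h
      by_cases h : i = i + 1 + 1
      · have h' : i - 1 = i + 1 := by rw [sub_eq_iff_eq_add, ← h]
        simp [incoming, ← h, h']
      · simp [incoming, h, backwardEdge]
  rw [Protocol.reaction, this]

/-- The input bits of the first `n` nodes, extended by `false` on the helper nodes. -/
def extendInput {n : ℕ} (N : ℕ) (x : Fin n → Bool) (i : Fin N) : Bool :=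
  if h : i.1 < n then x ⟨i.1, h⟩ else false

open Classical in
/-- The one-hot encoding of the labeling at time `t`, as a family of functions of the word. -/
noncomputable def labelIndicator (n : ℕ) (l₀ : A.Labeling) (t : ℕ)
    (k : Edge (bidirectionalRing N) × A.Label) (x : Fin n → Bool) : Bool :=
  decide (A.labeling (extendInput N x) l₀ t k.1 = k.2)

/-- A bound for the number of gates that evaluate a reaction function with label space of
size `K` on one-hot encoded labels. -/
def reactionCost (K : ℕ) : ℕ := K * (K * 11 + 3) + 1

theorem cost_reaction {n : ℕ} {F : Set ((Fin n → Bool) → Bool)} (l₀ : A.Labeling) (t : ℕ)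
    (hF : Set.range (labelIndicator A n l₀ t) ⊆ F) (i : Fin N)
    (φ : (OutEdge (bidirectionalRing N) i → A.Label) × Bool → Bool) :
    Cost F (fun x => φ (A.reaction (extendInput N x) (A.labeling (extendInput N x) l₀ t) i))
      (reactionCost (Fintype.card A.Label)) := by
  classical
  have hbit : ∀ b, Cost F (fun x : Fin n → Bool => decide (extendInput N x i = b)) 1 := by
    intro b
    by_cases h : i.1 < n
    · cases b
      · simpa [extendInput, h] using (cost_input (F := F) ⟨i.1, h⟩).not
      · simpa [extendInput, h] using (cost_input (F := F) ⟨i.1, h⟩).mono zero_le_one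
    · simpa [extendInput, h] using cost_const (F := F) (decide (false = b))
  have hlab : ∀ e σ, Cost F
      (fun x => decide (A.labeling (extendInput N x) l₀ t e = σ)) 0 := by
    intro e σ
    refine cost_of_mem (hF ⟨(e, σ), ?_⟩)
    funext x
    simp [labelIndicator]
  have h := cost_select _
    (fun a x => φ (A.react i (incoming A i a (A.labeling (extendInput N x) l₀ t (backwardEdge i)),
      extendInput N x i)))
    (hlab ⟨(i - 1, i), (bidirectionalRing_adj_iff _ _).2 (.inl (by simp))⟩) fun a =>
      cost_select _ (fun b x => φ (A.react i (incoming A i a b, extendInput N x i)))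
        (hlab (backwardEdge i)) fun b =>
          cost_select _ (fun y _ => φ (A.react i (incoming A i a b, y))) hbit fun y =>
            cost_const _
  simp only [← reaction_eq_incoming] at h
  refine h.mono (le_of_eq ?_)
  simp only [reactionCost, Fintype.card_bool]
  ring

theorem realizable_labelIndicator (n : ℕ) (l₀ : A.Labeling) (t : ℕ) :
    Realizable ((t + 1) * (Fintype.card (Fin N × Fin N × A.Label) *
      reactionCost (Fintype.card A.Label))) (Set.range (labelIndicator A n l₀ t)) := by
  classical
  have hcard : Fintype.card (Edge (bidirectionalRing N) × A.Label) ≤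
      Fintype.card (Fin N × Fin N × A.Label) :=
    Fintype.card_le_of_injective (fun k => (k.1.1.1, k.1.1.2, k.2)) fun k k' h => by
      simp only [Prod.mk.injEq] at h
      exact Prod.ext (Subtype.ext (Prod.ext h.1 h.2.1)) h.2.2
  have hle := Nat.mul_le_mul_right (reactionCost (Fintype.card A.Label)) hcard
  induction t with
  | zero =>
    have h0 : Realizable (n := n) 0 ∅ := ⟨.nil, by simp⟩
    have h1 : ∀ k, Cost ∅ (labelIndicator A n l₀ 0 k) (reactionCost (Fintype.card A.Label)) :=
      fun k => (cost_const (decide (l₀ k.1 = k.2))).mono (by simp [reactionCost])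
    exact ((h0.union_range h1).mono (by simpa using hle)).subset Set.subset_union_right
  | succ t ih =>
    have h1 : ∀ k, Cost (Set.range (labelIndicator A n l₀ t)) (labelIndicator A n l₀ (t + 1) k)
        (reactionCost (Fintype.card A.Label)) := fun k =>
      cost_reaction A l₀ t le_rfl k.1.1.1 fun r => decide (r.1 ⟨k.1.1.2, k.1.2⟩ = k.2)
    refine ((ih.union_range h1).mono ?_).subset Set.subset_union_right
    rw [add_mul (t + 1) 1, one_mul]
    exact Nat.add_le_add_left hle _

theorem exists_circuit_output (n : ℕ) (l₀ : A.Labeling) (t : ℕ) (i : Fin N) :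
    ∃ C : BoolCircuit n, (∀ x, C.eval x = A.outputSucc (extendInput N x) l₀ t i) ∧
      C.size = (t + 1) * (N * N * Fintype.card A.Label * reactionCost (Fintype.card A.Label)) +
        reactionCost (Fintype.card A.Label) := by
  obtain ⟨c, hc⟩ := cost_reaction A l₀ t le_rfl i (fun r => r.2) _ _ le_rfl
    (realizable_labelIndicator A n l₀ t)
  obtain ⟨w, hw⟩ := hc _ (Set.mem_insert _ _)
  refine ⟨⟨_, c, w⟩, hw, ?_⟩
  simp [mul_assoc]

end Simulation

theorem Protocol.outputSucc_eq_of_roundComplexity_le {V : Type} {G : Digraph V} {A : Protocol G}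
    {f : (V → Bool) → Bool} (hA : A.Computes f) {T : ℕ} (hT : A.roundComplexity ≤ T)
    (x : V → Bool) (l₀ : A.Labeling) (i : V) : A.outputSucc x l₀ T i = f x := by
  have h : A.convergenceTime x l₀ < ((T + 1 : ℕ) : ℕ∞) :=
    ((le_iSup₂ (f := fun x l₀ => A.convergenceTime x l₀) x l₀).trans hT).trans_lt
      (by exact_mod_cast T.lt_succ_self)
  obtain ⟨t, h⟩ := iInf_lt_iff.1 h
  obtain ⟨ht, h⟩ := iInf_lt_iff.1 h
  have htT : t < T := by
    have : t + 1 < T + 1 := by exact_mod_cast h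
    omega
  obtain ⟨s, hs, hts⟩ := ((hA x l₀ i).and (eventually_ge_atTop t)).exists
  rw [ht T htT.le, ← ht s hts, hs]

/-- Labels of logarithmic length come from label spaces of polynomial size. -/
theorem exists_polynomial_card_label {c : ℕ → ℕ} (hc : ∀ n, 0 < c n)
    (h : (fun n => Real.logb 2 (c n)) =O[atTop] fun n : ℕ => Real.log n) :
    ∃ q : Polynomial ℕ, ∀ n, c n ≤ q.eval n := by
  obtain ⟨C, hC⟩ := h.bound
  obtain ⟨n₀, hn₀⟩ := eventually_atTop.1 hC
  obtain ⟨d, hd⟩ := exists_nat_ge C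
  refine ⟨Polynomial.X ^ d + Polynomial.C (∑ k ∈ Finset.range (n₀ + 1), c k), fun n => ?_⟩
  simp only [Polynomial.eval_add, Polynomial.eval_pow, Polynomial.eval_X, Polynomial.eval_C]
  rcases lt_or_ge n (n₀ + 1) with hn | hn
  · exact (Finset.single_le_sum (f := c) (fun _ _ => Nat.zero_le _)
      (Finset.mem_range.2 hn)).trans (Nat.le_add_left _ _)
  · refine le_trans ?_ (Nat.le_add_right _ _)
    have hn1 : (1 : ℝ) ≤ n := by exact_mod_cast (by omega : 1 ≤ n)
    have hc1 : (1 : ℝ) ≤ c n := by exact_mod_cast hc n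
    have h0 : 0 ≤ Real.log n := Real.log_nonneg hn1
    have hlog : Real.log (c n) ≤ d * Real.log n := by
      have h1 := hn₀ n (by omega)
      rw [Real.norm_of_nonneg (Real.logb_nonneg (by norm_num) hc1), Real.norm_of_nonneg h0,
        Real.logb] at h1
      have h2 : Real.log (c n) ≤ Real.log (c n) / Real.log 2 :=
        le_div_self (Real.log_nonneg hc1) (Real.log_pos (by norm_num))
          (Real.log_two_lt_d9.le.trans (by norm_num))
      exact (h2.trans h1).trans (mul_le_mul_of_nonneg_right hd h0)
    rw [← Real.log_pow] at hlog
    have := (Real.log_le_log_iff (by linarith) (by positivity)).1 hlog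
    exact_mod_cast this

theorem OSBidirHelpers_log_subset_PPoly :
    OSBidirHelpers (fun n => Real.log n) ⊆ PPoly := by
  rintro L ⟨p, hn, A, hp3, ⟨P, hP⟩, ⟨T, hT⟩, hlab, hA⟩
  obtain ⟨K, hK⟩ := exists_polynomial_card_label (c := fun n => Fintype.card (A n).Label)
    (fun n => Fintype.card_pos) hlab
  have hp0 : ∀ n, NeZero (p n) := fun n => ⟨by have := hp3 n; omega⟩
  choose C hC hsize using fun n => exists_circuit_output (A n) n
    (fun _ => Classical.arbitrary _) (T.eval n) 0
  refine ⟨C, ⟨(T + 1) * (P * P * K * (K * (K * 11 + 3) + 1)) + (K * (K * 11 + 3) + 1),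
    fun n => ?_⟩, fun n x => ?_⟩
  · have hPn : p n ≤ P.eval n := Nat.cast_le.1 (hP n)
    have hKn := hK n
    rw [Nat.cast_le, hsize]
    simp only [Polynomial.eval_add, Polynomial.eval_mul, Polynomial.eval_one,
      Polynomial.eval_ofNat, reactionCost]
    gcongr
  · rw [hC, Protocol.outputSucc_eq_of_roundComplexity_le (hA n) (hT n)]
    congr
    funext i
    simp [extendInput]

/-! ### A ring of memory cells -/

/-- A straight-line program whose cells are the nodes of a ring: cell `i` holds the value of `op i`
at the input bit of node `i` and the contents of the cells `fst i` and `snd i`. The result is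
the content of the cell `out`. -/
structure CellProgram (N : ℕ) where
  fst : Fin N → Fin N
  snd : Fin N → Fin N
  op : Fin N → Bool → Bool → Bool → Bool
  out : Fin N

/-- A token travelling clockwise on the ring. -/
structure Token (N : ℕ) where
  /-- the cell that is to be written in the current revolution -/
  target : Fin N
  /-- the content of the first operand of the target, once its cell has been passed -/
  a : Bool
  /-- the content of the second operand of the target, once its cell has been passed -/
  b : Bool
  /-- the latest content of the output cell that the token has seen -/
  result : Bool

/-- A token amounts to a target and three bits. -/
def Token.equivProd (N : ℕ) : Token N ≃ Fin N × Bool × Bool × Bool where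
  toFun τ := (τ.target, τ.a, τ.b, τ.result)
  invFun q := ⟨q.1, q.2.1, q.2.2.1, q.2.2.2⟩

instance (N : ℕ) : Fintype (Token N) := Fintype.ofEquiv _ (Token.equivProd N).symm

theorem card_token (N : ℕ) : Fintype.card (Token N) = N * 8 := by
  simp [Fintype.card_congr (Token.equivProd N)]

section CellProgram

variable {N : ℕ} [NeZero N]

instance : Nonempty (Token N) := ⟨⟨0, false, false, false⟩⟩

namespace CellProgram

variable (P : CellProgram N)

/-- What node `i` with input bit `y` does with an arriving token `τ` and the content `m` of its
memory cell. The target advances at node `0`. -/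
def next (i : Fin N) (y : Bool) (τ : Token N) (m : Bool) : Token N × Bool :=
  let j := if i = 0 then τ.target + 1 else τ.target
  (⟨j, if P.fst j = i then m else τ.a, if P.snd j = i then m else τ.b,
    if P.out = i then m else τ.result⟩, if j = i then P.op i y τ.a τ.b else m)

/-- The protocol that executes `P`. The label of `(i, i + 1)` consists of a token and of the
content of cell `i`. Node `i + 1` sends this label back to `i` unchanged, so that `i` reads the
content that it wrote two steps earlier. -/
def protocol : Protocol (bidirectionalRing N) where
  Label := Token N × Bool
  react i q :=
    let l := q.1 ⟨i - 1, (bidirectionalRing_adj_iff _ _).2 (.inl (by simp))⟩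
    let r := P.next i q.2 l.1 (q.1 ⟨i + 1, (bidirectionalRing_adj_iff _ _).2 (.inr rfl)⟩).2
    (fun k => if k.1 = i + 1 then r else l, r.1.result)

/-- The label of the edge `(i, i + 1)` at time `t`. -/
def forward (x : Fin N → Bool) (l₀ : P.protocol.Labeling) (t : ℕ) (i : Fin N) : Token N × Bool :=
  P.protocol.labeling x l₀ t (forwardEdge i)

theorem labeling_pred (x : Fin N → Bool) (l₀ : P.protocol.Labeling) (t : ℕ) (i : Fin N)
    (h : (bidirectionalRing N).Adj (i - 1) i) :
    P.protocol.labeling x l₀ t ⟨(i - 1, i), h⟩ = P.forward x l₀ t (i - 1) := by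
  have : (⟨(i - 1, i), h⟩ : Edge (bidirectionalRing N)) = forwardEdge (i - 1) :=
    Subtype.ext (Prod.ext rfl (by simp [forwardEdge]))
  rw [this, forward]

theorem labeling_backwardEdge (hN : 3 ≤ N) (x : Fin N → Bool) (l₀ : P.protocol.Labeling) (t : ℕ)
    (i : Fin N) : P.protocol.labeling x l₀ (t + 1) (backwardEdge i) = P.forward x l₀ t i := by
  have h : ¬ i = i + 1 + 1 := by
    intro h
    rw [add_assoc, left_eq_add, Fin.ext_iff, Fin.val_add, Fin.val_one', Fin.val_zero,
      Nat.mod_eq_of_lt (by omega : 1 < N), Nat.mod_eq_of_lt (by omega)] at h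
    omega
  have e : P.protocol.labeling x l₀ (t + 1) (backwardEdge i) =
      if i = i + 1 + 1 then _ else
        P.protocol.labeling x l₀ t ⟨(i + 1 - 1, i + 1), (bidirectionalRing_adj_iff _ _).2
          (.inl (by simp))⟩ := rfl
  refine e.trans ((if_neg h).trans ?_)
  rw [labeling_pred, add_sub_cancel_right]

theorem outputSucc_eq (x : Fin N → Bool) (l₀ : P.protocol.Labeling) (t : ℕ) (i : Fin N) :
    P.protocol.outputSucc x l₀ t i = (P.forward x l₀ (t + 1) i).1.result := by
  have e : P.forward x l₀ (t + 1) i = if i + 1 = i + 1 then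
      P.next i (x i)
        (P.protocol.labeling x l₀ t ⟨(i - 1, i), (bidirectionalRing_adj_iff _ _).2
          (.inl (by simp))⟩).1 (P.protocol.labeling x l₀ t (backwardEdge i)).2 else _ := rfl
  rw [e, if_pos rfl]
  rfl

theorem forward_add_two (hN : 3 ≤ N) (x : Fin N → Bool) (l₀ : P.protocol.Labeling) (t : ℕ)
    (i : Fin N) : P.forward x l₀ (t + 2) (i + 1) = P.next (i + 1) (x (i + 1))
      (P.forward x l₀ (t + 1) i).1 (P.forward x l₀ t (i + 1)).2 := by
  have e : P.forward x l₀ (t + 2) (i + 1) = if i + 1 + 1 = i + 1 + 1 then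
      P.next (i + 1) (x (i + 1))
        (P.protocol.labeling x l₀ (t + 1) ⟨(i + 1 - 1, i + 1), (bidirectionalRing_adj_iff _ _).2
          (.inl (by simp))⟩).1
        (P.protocol.labeling x l₀ (t + 1) (backwardEdge (i + 1))).2 else _ := rfl
  rw [e, if_pos rfl, labeling_pred, add_sub_cancel_right, P.labeling_backwardEdge hN]

/-! ### Stabilization of the memory -/

/-- `val` is the content of the cells in an execution of `P` on the input `x`. An operation may use
an operand only if its cell precedes the cell of the operation. -/
def IsExecution (x val : Fin N → Bool) : Prop :=
  ∀ i a b, (P.fst i < i → a = val (P.fst i)) → (P.snd i < i → b = val (P.snd i)) →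
    P.op i (x i) a b = val i

/-- `L t i` is the label of the edge `(i, i + 1)` at time `t`, in a run of the protocol of `P` on
the input `x`. -/
def IsRun (x : Fin N → Bool) (L : ℕ → Fin N → Token N × Bool) : Prop :=
  ∀ t i, L (t + 2) i = P.next i (x i) (L (t + 1) (i - 1)).1 (L t i).2

theorem isRun_forward (hN : 3 ≤ N) (x : Fin N → Bool) (l₀ : P.protocol.Labeling) :
    P.IsRun x (P.forward x l₀) := fun t i => by
  simpa using P.forward_add_two hN x l₀ t (i - 1)

variable {P} {x val : Fin N → Bool} {L : ℕ → Fin N → Token N × Bool}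

open scoped Fin.NatCast Fin.CommRing

namespace IsRun

theorem target_eq (hL : P.IsRun x L) (t : ℕ) (i : Fin N) : (L (t + 2) i).1.target =
    if i = 0 then (L (t + 1) (i - 1)).1.target + 1 else (L (t + 1) (i - 1)).1.target := by
  rw [hL]; rfl

theorem a_eq (hL : P.IsRun x L) (t : ℕ) (i : Fin N) : (L (t + 2) i).1.a =
    if P.fst (L (t + 2) i).1.target = i then (L t i).2 else (L (t + 1) (i - 1)).1.a := by
  rw [hL]; rfl

theorem b_eq (hL : P.IsRun x L) (t : ℕ) (i : Fin N) : (L (t + 2) i).1.b =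
    if P.snd (L (t + 2) i).1.target = i then (L t i).2 else (L (t + 1) (i - 1)).1.b := by
  rw [hL]; rfl

theorem result_eq (hL : P.IsRun x L) (t : ℕ) (i : Fin N) : (L (t + 2) i).1.result =
    if P.out = i then (L t i).2 else (L (t + 1) (i - 1)).1.result := by
  rw [hL]; rfl

theorem memory_eq (hL : P.IsRun x L) (t : ℕ) (i : Fin N) : (L (t + 2) i).2 =
    if (L (t + 2) i).1.target = i then
      P.op i (x i) (L (t + 1) (i - 1)).1.a (L (t + 1) (i - 1)).1.b else (L t i).2 := by
  rw [hL]; rfl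

theorem target_add (hL : P.IsRun x L) (t k : ℕ) (hk : k < N) :
    (L (t + 1 + k) (k : Fin N)).1.target = (L (t + 1) 0).1.target := by
  induction k with
  | zero => simp
  | succ k ih =>
    have h : ((k + 1 : ℕ) : Fin N) ≠ 0 := by
      rw [Ne, Fin.ext_iff, Fin.val_natCast, Nat.mod_eq_of_lt hk]
      simp
    rw [show t + 1 + (k + 1) = t + k + 2 by ring, hL.target_eq, if_neg h, ← ih (by omega)]
    simp [add_right_comm]

theorem target_revolution (hL : P.IsRun x L) (t c : ℕ) :
    (L (t + 1 + c * N) 0).1.target = (L (t + 1) 0).1.target + (c : Fin N) := by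
  induction c with
  | zero => simp
  | succ c ih =>
    obtain ⟨M, hM⟩ : ∃ M, N = M + 1 := Nat.exists_eq_succ_of_ne_zero (NeZero.ne N)
    have hlast : (0 : Fin N) - 1 = (M : Fin N) := by
      rw [sub_eq_iff_eq_add, ← Nat.cast_succ, Nat.succ_eq_add_one, ← hM, Fin.natCast_self]
    have h := hL.target_add (t + c * N) M (by omega)
    rw [show t + 1 + (c + 1) * N = t + c * N + M + 2 by rw [add_mul c 1, one_mul]; omega,
      hL.target_eq, if_pos rfl, hlast,
      show t + c * N + M + 1 = t + c * N + 1 + M by ring, h,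
      show t + c * N + 1 = t + 1 + c * N by ring, ih]
    push_cast
    ring

/-- A register `r` of the tokens that is loaded from the cell `src j` in the revolution with target
`j` holds the content of that cell from there to the end of the revolution. -/
theorem register_eq (hL : P.IsRun x L) {r : ℕ → Fin N → Bool} {src : Fin N → Fin N}
    (hr : ∀ t i, r (t + 2) i =
      if src (L (t + 2) i).1.target = i then (L t i).2 else r (t + 1) (i - 1))
    {S t k : ℕ} {v : Bool} {j : Fin N} (hj : (L (t + 1) 0).1.target = j)
    (hv : ∀ t, S ≤ t → (L t (src j)).2 = v) (ht : S + 1 ≤ t) (hk : k < N)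
    (hjk : (src j).1 ≤ k) : r (t + 1 + k) (k : Fin N) = v := by
  obtain ⟨t, rfl⟩ : ∃ t', t = t' + 1 := ⟨t - 1, by omega⟩
  induction k with
  | zero =>
    have h0 : src j = 0 := Fin.ext (by simpa using hjk)
    have h := hr t 0
    rw [show t + 2 = t + 1 + 1 by rfl, hj, if_pos h0, ← h0, hv t (by omega)] at h
    simpa [h0] using h
  | succ k ih =>
    have h := hr (t + k + 1) ((k + 1 : ℕ) : Fin N)
    rw [show t + k + 1 + 2 = t + 1 + 1 + (k + 1) by ring, hL.target_add _ _ hk, hj] at h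
    rw [h]
    split_ifs with he
    · rw [← he, hv _ (by omega)]
    · have hne : (src j).1 ≠ k + 1 := fun hne => he <| by
        rw [← hne, Fin.cast_val_eq_self]
      rw [← ih (by omega) (by omega)]
      simp [add_assoc, add_comm, add_left_comm]

/-- If the cells before `i` are correct from time `S` on, then so is whatever is written into cell
`i` from time `S + N + 3` on. -/
theorem memory_of_target (hL : P.IsRun x L) (hval : P.IsExecution x val) {S : ℕ} {i : Fin N}
    (hS : ∀ u < i, ∀ t, S ≤ t → (L t u).2 = val u) {t : ℕ} (ht : S + N + 3 ≤ t)
    (hi : (L t i).1.target = i) : (L t i).2 = val i := by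
  obtain ⟨t, rfl⟩ : ∃ t', t = t' + 1 + i.1 := ⟨t - 1 - i.1, by omega⟩
  have htarget : (L (t + 1) 0).1.target = i := by
    have h := hL.target_add t i.1 i.2
    rw [Fin.cast_val_eq_self] at h
    rw [← h, hi]
  have key : ∀ {r : ℕ → Fin N → Bool} {src : Fin N → Fin N}, (∀ t i, r (t + 2) i =
      if src (L (t + 2) i).1.target = i then (L t i).2 else r (t + 1) (i - 1)) →
      src i < i → r (t + i.1) (i - 1) = val (src i) := by
    intro r src hr hsrc
    obtain ⟨k, hk⟩ : ∃ k, i.1 = k + 1 := Nat.exists_eq_succ_of_ne_zero (by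
      have := Fin.lt_def.1 hsrc
      omega)
    have hik : i - 1 = (k : Fin N) := by
      rw [sub_eq_iff_eq_add, ← Nat.cast_succ, Nat.succ_eq_add_one, ← hk, Fin.cast_val_eq_self]
    rw [hik, hk, show t + (k + 1) = t + 1 + k by ring]
    exact hL.register_eq hr htarget (hS _ hsrc) (by omega) (by omega)
      (by have := Fin.lt_def.1 hsrc; omega)
  obtain ⟨t', ht'⟩ : ∃ t', t + 1 + i.1 = t' + 2 := ⟨t + i.1 - 1, by omega⟩
  have ht'' : t' + 1 = t + i.1 := by omega
  rw [ht'] at hi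
  rw [ht', hL.memory_eq, if_pos hi, ht'']
  exact hval i _ _ (key (r := fun t i => (L t i).1.a) hL.a_eq)
    (key (r := fun t i => (L t i).1.b) hL.b_eq)

/-- The time in which the next cell stabilizes. -/
theorem memory_stable_step (hL : P.IsRun x L) (hN : Even N) (hval : P.IsExecution x val) {S : ℕ}
    {i : Fin N} (hS : ∀ u < i, ∀ t, S ≤ t → (L t u).2 = val u) {t : ℕ}
    (ht : S + (N * N + N + 3) ≤ t) : (L t i).2 = val i := by
  have keep : ∀ m t, S + N + 3 ≤ t → (L t i).2 = val i → (L (t + 2 * m) i).2 = val i := by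
    intro m t ht h
    induction m with
    | zero => exact h
    | succ m ih =>
      by_cases hi : (L (t + 2 * (m + 1)) i).1.target = i
      · exact hL.memory_of_target hval hS (by omega) hi
      · rw [show t + 2 * (m + 1) = t + 2 * m + 2 by ring] at hi ⊢
        rw [hL.memory_eq, if_neg hi, ih]
  obtain ⟨t₀, rfl⟩ : ∃ t₀, t = t₀ + 1 + i.1 + N * N := ⟨t - N * N - i.1 - 1, by omega⟩
  -- the number of revolutions after which the token that is now at node `i` has target `i`
  set c := (i - (L (t₀ + 1) 0).1.target).1 with hc
  have hcN : c < N := Fin.is_lt _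
  have htarget : (L (t₀ + c * N + 1 + i.1) i).1.target = i := by
    have h := hL.target_add (t₀ + c * N) i.1 i.2
    rw [Fin.cast_val_eq_self, show t₀ + c * N + 1 = t₀ + 1 + c * N by ring,
      hL.target_revolution, hc, Fin.cast_val_eq_self, add_sub_cancel] at h
    rw [show t₀ + c * N + 1 + i.1 = t₀ + 1 + c * N + i.1 by ring, h]
  have hwrite := hL.memory_of_target hval hS
    (t := t₀ + c * N + 1 + i.1) (by omega) htarget
  -- `N` is even, so all revolutions of a token see the same of the two contents of the cell
  obtain ⟨M, hM⟩ := hN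
  have hle : c * N ≤ N * N := Nat.mul_le_mul_right _ hcN.le
  have hsub : N * N - c * N = 2 * ((N - c) * M) := by
    rw [← Nat.sub_mul]
    conv_lhs => rw [show (N - c) * N = (N - c) * (M + M) by rw [← hM]]
    ring
  have := keep ((N - c) * M) _ (by omega) hwrite
  rwa [← hsub, show t₀ + c * N + 1 + i.1 + (N * N - c * N) = t₀ + 1 + i.1 + N * N by omega]
    at this

theorem memory_stable (hL : P.IsRun x L) (hN : Even N) (hval : P.IsExecution x val) (k : ℕ) :
    ∀ u : Fin N, u.1 < k → ∀ t, k * (N * N + N + 3) ≤ t → (L t u).2 = val u := by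
  induction k with
  | zero => simp
  | succ k ih =>
    intro u hu t ht
    rw [add_mul k 1, one_mul] at ht
    rcases Nat.lt_succ_iff_lt_or_eq.1 hu with hu | hu
    · exact ih u hu t (by omega)
    · exact hL.memory_stable_step hN hval
        (fun v hv t ht => ih v (hu ▸ Fin.lt_def.1 hv) t ht) ht

theorem result_stable (hL : P.IsRun x L) (hN : Even N) (hval : P.IsExecution x val) {t : ℕ}
    (ht : N * (N * N + N + 3) + N + 2 ≤ t) (i : Fin N) :
    (L t i).1.result = val P.out := by
  have hmem := fun t ht => hL.memory_stable hN hval N P.out P.out.2 t ht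
  have h : ∀ k t, N * (N * N + N + 3) ≤ t →
      (L (t + 2 + k) (P.out + (k : Fin N))).1.result = val P.out := by
    intro k t ht
    induction k with
    | zero => simp [hL.result_eq, hmem t ht]
    | succ k ih =>
      rw [show t + 2 + (k + 1) = t + k + 1 + 2 by ring, hL.result_eq]
      split_ifs with he
      · rw [← he, hmem _ (by omega)]
      · rw [← ih]
        simp [add_comm, add_left_comm, ← add_assoc]
  have := h (i - P.out).1 (t - 2 - (i - P.out).1) (by omega)
  rwa [Fin.cast_val_eq_self, add_sub_cancel,
    show t - 2 - (i - P.out).1 + 2 + (i - P.out).1 = t by omega] at this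

end IsRun

/-- Every output of the protocol of `P` is the result of `P` from this time on. -/
theorem outputSucc_eq_result (hN3 : 3 ≤ N) (hN : Even N) (hval : P.IsExecution x val)
    (l₀ : P.protocol.Labeling) {t : ℕ} (ht : N * (N * N + N + 3) + N + 2 ≤ t) (i : Fin N) :
    P.protocol.outputSucc x l₀ t i = val P.out := by
  rw [outputSucc_eq]
  exact (P.isRun_forward hN3 x l₀).result_stable hN hval (by omega) i

theorem card_label (P : CellProgram N) : Fintype.card P.protocol.Label = 16 * N := by
  have : Fintype.card P.protocol.Label = Fintype.card (Token N × Bool) := rfl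
  rw [this, Fintype.card_prod, card_token, Fintype.card_bool]
  ring

end CellProgram
end CellProgram
/-! ### Executing a circuit on the ring -/

section CircuitExecution

variable {n s : ℕ}

/-- The number of a wire: the inputs come first, then the gates. -/
def wireIndex : Fin n ⊕ Fin s → ℕ := Sum.elim (fun i => i.1) fun j => n + j.1

theorem wireIndex_lt (w : Fin n ⊕ Fin s) : wireIndex w < n + s := by
  rcases w with i | j
  · exact i.2.trans_le (Nat.le_add_right _ _)
  · exact Nat.add_lt_add_left j.2 _

/-- The values of all wires, by their numbers; `false` for numbers that are too large. -/
def GateSeq.wireValue (c : GateSeq n s) (x : Fin n → Bool) (k : ℕ) : Bool :=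
  if h : k < n then x ⟨k, h⟩ else if h' : k - n < s then c.values x ⟨k - n, h'⟩ else false

theorem GateSeq.wireValue_wireIndex (c : GateSeq n s) (x : Fin n → Bool) (w : Fin n ⊕ Fin s) :
    c.wireValue x (wireIndex w) = Sum.elim x (c.values x) w := by
  rcases w with i | j <;> simp [wireValue, wireIndex]

theorem GateSeq.wireValue_snoc_of_lt (c : GateSeq n s) (g : Gate (Fin n ⊕ Fin s))
    (x : Fin n → Bool) {k : ℕ} (hk : k < n + s) :
    (c.snoc g).wireValue x k = c.wireValue x k := by
  by_cases h : k < n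
  · simp [wireValue, h]
  · have h1 : k - n < s := by omega
    have h2 : k - n < s + 1 := by omega
    simp only [wireValue, h, h1, h2, dif_pos, dif_neg, not_false_eq_true]
    exact Fin.snoc_castSucc (α := fun _ => Bool) _ _ (⟨k - n, h1⟩ : Fin s)

theorem GateSeq.wireValue_snoc_last (c : GateSeq n s) (g : Gate (Fin n ⊕ Fin s))
    (x : Fin n → Bool) :
    (c.snoc g).wireValue x (n + s) = g.eval (Sum.elim x (c.values x)) := by
  simp only [wireValue, Nat.not_lt.2 (Nat.le_add_right n s), Nat.add_sub_cancel_left,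
    Nat.lt_succ_self, dif_pos, dif_neg, not_false_eq_true]
  exact Fin.snoc_last (α := fun _ => Bool) _ _

/-- A gate as a binary operation on two wires, whose values matter only if they are available. -/
theorem Gate.exists_operation (g : Gate (Fin n ⊕ Fin s)) :
    ∃ (u v : ℕ) (o : Bool → Bool → Bool), ∀ (c : GateSeq n s) (x : Fin n → Bool) (a b : Bool),
      (u < n + s → a = c.wireValue x u) → (v < n + s → b = c.wireValue x v) →
        o a b = g.eval (Sum.elim x (c.values x)) := by
  cases g with
  | const b => exact ⟨0, 0, fun _ _ => b, fun _ _ _ _ _ _ => rfl⟩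
  | not w =>
    refine ⟨wireIndex w, 0, fun a _ => !a, fun c x a b ha _ => ?_⟩
    simp [Gate.eval, ha (wireIndex_lt w), c.wireValue_wireIndex]
  | and w w' =>
    refine ⟨wireIndex w, wireIndex w', fun a b => a && b, fun c x a b ha hb => ?_⟩
    simp [Gate.eval, ha (wireIndex_lt w), hb (wireIndex_lt w'), c.wireValue_wireIndex]
  | or w w' =>
    refine ⟨wireIndex w, wireIndex w', fun a b => a || b, fun c x a b ha hb => ?_⟩
    simp [Gate.eval, ha (wireIndex_lt w), hb (wireIndex_lt w'), c.wireValue_wireIndex]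

theorem GateSeq.exists_operations (c : GateSeq n s) :
    ∃ (u v : ℕ → ℕ) (o : ℕ → Bool → Bool → Bool), ∀ (x : Fin n → Bool), ∀ j < s, ∀ a b : Bool,
      (u j < n + j → a = c.wireValue x (u j)) → (v j < n + j → b = c.wireValue x (v j)) →
        o j a b = c.wireValue x (n + j) := by
  induction c with
  | nil => exact ⟨fun _ => 0, fun _ => 0, fun _ _ _ => false, by simp⟩
  | @snoc s c g ih =>
    obtain ⟨u, v, o, h⟩ := ih
    obtain ⟨u', v', o', h'⟩ := g.exists_operation
    refine ⟨Function.update u s u', Function.update v s v', Function.update o s o',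
      fun x j hj a b ha hb => ?_⟩
    rcases Nat.lt_succ_iff_lt_or_eq.1 hj with hj | rfl
    · simp only [Function.update_of_ne hj.ne] at ha hb ⊢
      rw [c.wireValue_snoc_of_lt g x (by omega)]
      refine h x j hj a b (fun hu => ?_) fun hv => ?_
      · rw [ha hu, c.wireValue_snoc_of_lt g x (by omega)]
      · rw [hb hv, c.wireValue_snoc_of_lt g x (by omega)]
    · simp only [Function.update_self] at ha hb ⊢
      rw [c.wireValue_snoc_last]
      refine h' c x a b (fun hu => ?_) fun hv => ?_
      · rw [ha hu, c.wireValue_snoc_of_lt g x hu]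
      · rw [hb hv, c.wireValue_snoc_of_lt g x hv]

theorem BoolCircuit.exists_cellProgram (C : BoolCircuit n) {N : ℕ} [NeZero N]
    (hN : n + C.size ≤ N) :
    ∃ P : CellProgram N, ∀ x : Fin N → Bool, ∃ val : Fin N → Bool, P.IsExecution x val ∧
      val P.out = C.eval fun i => x (Fin.castLE ((Nat.le_add_right _ _).trans hN) i) := by
  obtain ⟨u, v, o, h⟩ := C.gates.exists_operations
  refine ⟨⟨fun i => Fin.ofNat N (u (i - n)), fun i => Fin.ofNat N (v (i - n)),
    fun i y a b => if i.1 < n then y else if i.1 < n + C.size then o (i - n) a b else false,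
    Fin.ofNat N (wireIndex C.output)⟩, fun x => ?_⟩
  set x' : Fin n → Bool := fun i => x (Fin.castLE ((Nat.le_add_right _ _).trans hN) i)
  refine ⟨fun i => C.gates.wireValue x' i, fun i a b ha hb => ?_, ?_⟩
  · dsimp only at ha hb ⊢
    split_ifs with h1 h2
    · simp [GateSeq.wireValue, h1, x']
    · have hi : n + (i.1 - n) = i.1 := by omega
      have hmod : ∀ k, k < n + (i.1 - n) → (Fin.ofNat N k).1 = k := fun k hk =>
        Nat.mod_eq_of_lt (by omega)
      rw [h x' (i.1 - n) (by omega) a b (fun hu => ?_) fun hv => ?_, hi]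
      · rw [ha (Fin.lt_def.2 (by rw [hmod _ hu]; omega)), hmod _ hu]
      · rw [hb (Fin.lt_def.2 (by rw [hmod _ hv]; omega)), hmod _ hv]
    · have h3 : ¬ i.1 - n < C.size := by omega
      simp [GateSeq.wireValue, h1, h3]
  · have := wireIndex_lt C.output
    dsimp only
    rw [Fin.val_ofNat, Nat.mod_eq_of_lt (by omega), C.gates.wireValue_wireIndex]
    rfl

end CircuitExecution

theorem Protocol.roundComplexity_le {V : Type} {G : Digraph V} {A : Protocol G} {T : ℕ}
    {f : (V → Bool) → Bool} (h : ∀ x l₀ t, T ≤ t → ∀ i, A.outputSucc x l₀ t i = f x) :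
    A.roundComplexity ≤ (T + 1 : ℕ) :=
  iSup₂_le fun x l₀ => iInf₂_le T fun s hs => by
    funext i
    rw [h x l₀ s hs, h x l₀ T le_rfl]

theorem isBigO_logb_of_le_polynomial {c : ℕ → ℕ} (q : Polynomial ℕ) (hc : ∀ n, 0 < c n)
    (h : ∀ n, c n ≤ q.eval n) :
    (fun n => Real.logb 2 (c n)) =O[atTop] fun n : ℕ => Real.log n := by
  -- for `n ≥ 2`, `q n ≤ q 1 * n ^ d ≤ n ^ (q 1 + d)`
  have hq : ∀ n, 1 ≤ n → q.eval n ≤ q.eval 1 * n ^ q.natDegree := by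
    intro n hn
    simp only [Polynomial.eval_eq_sum_range, one_pow, mul_one, Finset.sum_mul]
    exact Finset.sum_le_sum fun i hi => Nat.mul_le_mul_left _
      (Nat.pow_le_pow_right hn (by simpa [Nat.lt_succ_iff] using hi))
  refine IsBigO.of_bound ((q.eval 1 + q.natDegree) / Real.log 2) ?_
  filter_upwards [eventually_ge_atTop 2] with n hn
  have hle : c n ≤ n ^ (q.eval 1 + q.natDegree) := by
    rw [pow_add]
    exact (h n).trans ((hq n (by omega)).trans
      (Nat.mul_le_mul_right _ (Nat.lt_pow_self (by omega)).le))
  have hc1 : (1 : ℝ) ≤ c n := by exact_mod_cast hc n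
  have hn1 : (1 : ℝ) ≤ n := by exact_mod_cast (by omega : 1 ≤ n)
  have hle' : (c n : ℝ) ≤ (n : ℝ) ^ (q.eval 1 + q.natDegree) := by exact_mod_cast hle
  have hlog := Real.log_le_log (by linarith) hle'
  rw [Real.log_pow] at hlog
  rw [Real.norm_of_nonneg (Real.logb_nonneg (by norm_num) hc1),
    Real.norm_of_nonneg (Real.log_nonneg hn1), Real.logb, div_mul_eq_mul_div]
  have h2 : 0 < Real.log 2 := Real.log_pos (by norm_num)
  gcongr
  exact_mod_cast hlog

theorem PPoly_subset_OSBidirHelpers_log :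
    PPoly ⊆ OSBidirHelpers (fun n => Real.log n) := by
  rintro L ⟨C, ⟨S, hS⟩, hC⟩
  have hS' : ∀ n, (C n).size ≤ S.eval n := fun n => Nat.cast_le.1 (hS n)
  -- the ring has an even number of nodes, at least three and at least one for each wire
  set p : ℕ → ℕ := fun n => 2 * (n + (C n).size + 2) with hp
  have hp3 : ∀ n, 3 ≤ p n := fun n => by simp only [hp]; omega
  have hp0 : ∀ n, NeZero (p n) := fun n => ⟨by have := hp3 n; omega⟩
  have hnp : ∀ n, n + (C n).size ≤ p n := fun n => by simp only [hp]; omega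
  have hpe : ∀ n, Even (p n) := fun n => even_two_mul _
  set q : Polynomial ℕ := 2 * (Polynomial.X + S + 2) with hq
  have hpq : ∀ n, p n ≤ q.eval n := fun n => by
    have := hS' n
    simp only [hp, hq, Polynomial.eval_mul, Polynomial.eval_add, Polynomial.eval_X,
      Polynomial.eval_ofNat]
    omega
  choose P hP using fun n => (C n).exists_cellProgram (hnp n)
  have hout : ∀ n (x : Fin (p n) → Bool) l₀ t,
      p n * (p n * p n + p n + 3) + p n + 2 ≤ t → ∀ i, (P n).protocol.outputSucc x l₀ t i =
        indicatorFn L n fun i => x (Fin.castLE ((Nat.le_add_right _ _).trans (hnp n)) i) := by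
    intro n x l₀ t ht i
    obtain ⟨val, hval, hv⟩ := hP n x
    rw [CellProgram.outputSucc_eq_result (hp3 n) (hpe n) hval l₀ ht i, hv, hC]
  refine ⟨p, fun n => (Nat.le_add_right _ _).trans (hnp n), fun n => (P n).protocol, hp3,
    ⟨q, fun n => Nat.cast_le.2 (hpq n)⟩, ⟨q * (q * q + q + 3) + q + 2 + 1, fun n => ?_⟩, ?_,
    fun n x l₀ i => ?_⟩
  · refine (Protocol.roundComplexity_le (hout n)).trans (Nat.cast_le.2 ?_)
    have := hpq n
    simp only [Polynomial.eval_mul, Polynomial.eval_add, Polynomial.eval_one,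
      Polynomial.eval_ofNat]
    gcongr
  · refine isBigO_logb_of_le_polynomial (16 * q) (fun n => Fintype.card_pos) fun n => ?_
    rw [CellProgram.card_label]
    simpa using hpq n
  · filter_upwards [eventually_ge_atTop _] with t ht
    exact hout n x l₀ t ht i

end Stateless

theorem theorem5 :
    Stateless.OSBidirHelpers (fun n => Real.log n) = Stateless.PPoly :=
  Set.Subset.antisymm Stateless.OSBidirHelpers_log_subset_PPoly
    Stateless.PPoly_subset_OSBidirHelpers_log
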